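/- **Theorem (density estimation).** Fix $\eta\in(0,1)$ and $\Gamma>0$. Let $\mathcal{F}_{\eta,\Gamma}$ be the set of probability densities $f$ on $[0,1]$ (with respect to Lebesgue measure) such that $f(y)\ge\eta$ for all $y\in[0,1]$ and $\|f\|_{\mathrm{TV}}\le\Gamma$, where $$\|f\|_{\mathrm{TV}}=\sup_{L\ge 1}\ \sup_{0\le x_1\le\dots\le x_L\le 1}\ \sum_{l=2}^{L}|f(x_l)-f(x_{l-1})|$$ is the total variation. For $n\in\mathbb{N}$ define the minimax risk $$\mathcal{M}_n(\eta,\Gamma)=\inf_{\hat f}\ \sup_{f\in\mathcal{F}_{\eta,\Gamma}}\mathbb{E}_f\big[\|f-\hat f\|_2^2\big],\qquad \|f-\hat f\|_2^2=\int_0^1\big(f(x)-\hat f(x)\big)^2\,dx\in[0,\infty],$$ where $\mathbb{E}_f$ is the expectation over independent samples $Y_1,\dots,Y_n$ with density $f$, and the infimum is over all estimators, i.e. all maps $\hat f:[0,1]^n\times[0,1]\to\mathbb{R}$, $(y,x)\mapsto\hat f(y)(x)$, that are jointly (Borel) measurable. Then there exist constants $c>0$ and $\delta_0>0$, depending only on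 $\eta$ and $\Gamma$, such that for every $\delta\in(0,\delta_0]$ and every $n\in\mathbb{N}$, $\mathcal{M}_n(\eta,\Gamma)\le\delta$ implies $$n\ \ge\ c\,\Big(\frac{1}{\delta}\Big)^{3/2}.$$ In other words, $\mathcal{M}_n(\eta,\Gamma)=\Omega(n^{-2/3})$: there are $c'>0$ and $N\in\mathbb{N}$, depending only on $\eta$ and $\Gamma$, such that $\mathcal{M}_n(\eta,\Gamma)\ge c'\,n^{-2/3}$ for all $n\ge N$. -/

import Mathlib

open MeasureTheory
open scoped ENNReal unitInterval

/-- The class `F_{η,Γ}` of probability densities `f` on `[0,1]` (with respect to Lebesgue measure)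
that satisfy `f ≥ η` everywhere and have total variation at most `Γ`. -/
def densityClass (η Γ : ℝ) : Set (I → ℝ) :=
  {f | Measurable f ∧ (∀ y, 0 ≤ f y) ∧ ∫⁻ y, ENNReal.ofReal (f y) = 1 ∧
    (∀ y, η ≤ f y) ∧ eVariationOn f Set.univ ≤ ENNReal.ofReal Γ}

/-- The joint law of `n` independent samples, each with density `f` on `[0,1]`. -/
noncomputable def sampleLaw (n : ℕ) (f : I → ℝ) : Measure (Fin n → I) :=
  Measure.pi fun _ => (volume : Measure I).withDensity fun y => ENNReal.ofReal (f y)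

/-- The squared `L²` loss `∫₀¹ (f x - g x)² dx`, with the value `∞` if the integral diverges. -/
noncomputable def sqL2Loss (f g : I → ℝ) : ℝ≥0∞ :=
  ∫⁻ x, ENNReal.ofReal ((f x - g x) ^ 2)

/-- A density estimator from `n` samples: it maps the samples `y` to a real function
`x ↦ fhat y x` on `[0,1]`, and is jointly measurable in `(y, x)`.
The estimate need not itself belong to the class, nor be a density. -/
def IsDensityEstimator (n : ℕ) (fhat : (Fin n → I) → I → ℝ) : Prop :=
  Measurable (Function.uncurry fhat)

/-- The minimax risk `inf_fhat sup_f E_f [‖f - fhat‖₂²]` over all estimators from `n` samples. -/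
noncomputable def densityMinimaxRisk (η Γ : ℝ) (n : ℕ) : ℝ≥0∞ :=
  ⨅ (fhat : (Fin n → I) → I → ℝ) (_ : IsDensityEstimator n fhat),
    ⨆ f ∈ densityClass η Γ, ∫⁻ y, sqL2Loss f (fhat y) ∂(sampleLaw n f)

/-! Assouad's method. Split `[0,1]` into `m` cells and perturb the uniform density by `+a` on one
half of each cell and `-a` on the other, the orientation on cell `k` being a free bit. The halves
cancel, so each of the `2 ^ m` choices is a density; its variation is at most `4 * a * m`.

Flipping one bit changes the density on a single cell, of mass `1 / m`, and lowers the affinity of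
the one-sample laws by at most `a ^ 2 / m`. While `n * a ^ 2` is at most `m / 4`, `n` samples cannot
determine the bit (`two_point_bound`), and any estimator loses order `a ^ 2 / m` on that cell under
one of the two densities (`flip_risk_bound`). Averaging over all bit strings and adding up the `m`
cells gives risk at least `a ^ 2 / 4` (`le_densityMinimaxRisk`). The variation bound forces `a` to
be of order `1 / m`, so `m` may be of order `n ^ (1/3)`, and the risk is of order `n ^ (-2/3)`. -/

/-! ### Product laws and the two-point bound. -/

/-- Tonelli's theorem for a product of nonnegative functions of separate coordinates. -/
theorem lintegral_fin_prod_eq_prod {E : Type*} [MeasurableSpace E] (μ : Measure E) [SigmaFinite μ]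
    {n : ℕ} (f : Fin n → E → ℝ≥0∞) (hf : ∀ i, Measurable (f i)) :
    ∫⁻ x, ∏ i, f i (x i) ∂(Measure.pi fun _ : Fin n => μ) = ∏ i, ∫⁻ x, f i x ∂μ := by
  induction n with
  | zero => simp
  | succ n ih =>
    have h := (measurePreserving_piFinSuccAbove (fun _ : Fin (n + 1) => μ) 0).symm
    rw [← h.lintegral_comp_emb (MeasurableEquiv.measurableEmbedding _)]
    simp_rw [MeasurableEquiv.piFinSuccAbove_symm_apply, Fin.insertNthEquiv,
      Fin.prod_univ_succ, Fin.insertNth_zero, Equiv.coe_fn_mk, Fin.cons_succ, Fin.cons_zero,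
      cast_eq]
    have hg : Measurable fun y : Fin n → E => ∏ i, f i.succ (y i) :=
      Finset.measurable_prod _ fun i _ => (hf i.succ).comp (measurable_pi_apply i)
    rw [lintegral_prod_mul (hf 0).aemeasurable hg.aemeasurable, ih _ fun i => hf i.succ]

theorem pi_withDensity_eq {E : Type*} [MeasurableSpace E] (μ : Measure E) [SigmaFinite μ]
    (n : ℕ) (f : E → ℝ≥0∞) (hf : Measurable f) [SigmaFinite (μ.withDensity f)] :
    (Measure.pi fun _ : Fin n => μ.withDensity f) =
      (Measure.pi fun _ : Fin n => μ).withDensity fun x => ∏ i, f (x i) := by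
  refine Measure.pi_eq fun s hs => ?_
  rw [withDensity_apply _ (MeasurableSet.univ_pi hs),
    ← lintegral_indicator (MeasurableSet.univ_pi hs)]
  simp_rw [withDensity_apply _ (hs _), ← lintegral_indicator (hs _)]
  rw [← lintegral_fin_prod_eq_prod μ (fun i => (s i).indicator f) fun i => hf.indicator (hs i)]
  refine lintegral_congr fun x => ?_
  by_cases hx : x ∈ Set.univ.pi s
  · rw [Set.indicator_of_mem hx]
    exact Finset.prod_congr rfl fun i _ => (Set.indicator_of_mem (hx i trivial) f).symm
  · rw [Set.indicator_of_notMem hx]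
    obtain ⟨i, hi⟩ : ∃ i, x i ∉ s i := by simpa using hx
    exact (Finset.prod_eq_zero (Finset.mem_univ i) (Set.indicator_of_notMem hi f)).symm

/-- AM-GM: the root of `p * q` is twice the root of `min * (max / 4)`, hence at most `min + max /
4`. Being linear in `p` and `q`, the bound integrates directly and replaces Cauchy-Schwarz for the
affinity. -/
theorem le_min_add_quarter {r p q : ℝ≥0∞} (h : r ^ 2 ≤ p * q) : r ≤ min p q + (p + q) / 4 := by
  by_cases hp : p = ⊤
  · simp [hp, ENNReal.top_div]
  by_cases hq : q = ⊤
  · simp [hq, ENNReal.top_div]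
  have hr : r ≠ ⊤ := by
    rintro rfl
    simp [ENNReal.mul_eq_top, hp, hq] at h
  lift p to NNReal using hp
  lift q to NNReal using hq
  lift r to NNReal using hr
  have h4 : ((4 : NNReal) : ℝ≥0∞) = 4 := by norm_num
  rw [← h4, ← ENNReal.coe_add, ← ENNReal.coe_div (by norm_num), ← ENNReal.coe_min]
  norm_cast at h ⊢
  rw [← NNReal.coe_le_coe] at h ⊢
  push_cast at h ⊢
  refine abs_le_of_sq_le_sq' ?_ (by positivity) |>.2
  rcases le_total (p : ℝ) q with hpq | hpq
  · rw [min_eq_left hpq]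
    nlinarith [sq_nonneg ((p : ℝ) - q / 4), mul_nonneg p.2 p.2, mul_nonneg p.2 q.2]
  · rw [min_eq_right hpq]
    nlinarith [sq_nonneg ((q : ℝ) - p / 4), mul_nonneg q.2 q.2, mul_nonneg p.2 q.2]

/-- Le Cam's two-point bound for product laws: a function `r` with `r ^ 2 ≤ f * g` whose integral
has `n`-th power at least `3 / 4` bounds the affinity of the two laws from below. -/
theorem two_point_bound {E : Type*} [MeasurableSpace E] (μ : Measure E) [SigmaFinite μ] {n : ℕ}
    {f g r : E → ℝ≥0∞} (hf : Measurable f) (hg : Measurable g) (hr : Measurable r)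
    (hf1 : ∫⁻ x, f x ∂μ = 1) (hg1 : ∫⁻ x, g x ∂μ = 1) (hrfg : ∀ x, r x ^ 2 ≤ f x * g x)
    (hr1 : 3 / 4 ≤ (∫⁻ x, r x ∂μ) ^ n) {A B : (Fin n → E) → ℝ≥0∞} (hA : Measurable A)
    (hB : Measurable B) {s : ℝ≥0∞} (hs : s ≠ ⊤) (hAB : ∀ y, s ≤ A y + B y) :
    s / 4 ≤ ∫⁻ y, A y ∂(Measure.pi fun _ => μ.withDensity f) +
      ∫⁻ y, B y ∂(Measure.pi fun _ => μ.withDensity g) := by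
  have : IsFiniteMeasure (μ.withDensity f) := isFiniteMeasure_withDensity (by simp [hf1])
  have : IsFiniteMeasure (μ.withDensity g) := isFiniteMeasure_withDensity (by simp [hg1])
  have hprod : ∀ {h : E → ℝ≥0∞}, Measurable h →
      Measurable fun y : Fin n → E => ∏ i, h (y i) := fun hh =>
    Finset.measurable_prod _ fun i _ => hh.comp (measurable_pi_apply i)
  have hint : ∀ {h : E → ℝ≥0∞}, Measurable h →
      ∫⁻ y, ∏ i, h (y i) ∂(Measure.pi fun _ : Fin n => μ) = (∫⁻ x, h x ∂μ) ^ n := fun hh => by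
    rw [lintegral_fin_prod_eq_prod μ _ fun _ => hh]
    simp
  rw [pi_withDensity_eq μ n f hf, pi_withDensity_eq μ n g hg,
    lintegral_withDensity_eq_lintegral_mul _ (hprod hf) hA,
    lintegral_withDensity_eq_lintegral_mul _ (hprod hg) hB]
  simp only [Pi.mul_apply]
  set ν := Measure.pi fun _ : Fin n => μ
  -- Integrated, this reads `3 / 4 * s ≤ risks + s / 2`. Cancelling `s / 2`, which needs `s` finite,
  -- leaves `s / 4`.
  have key : ∀ y : Fin n → E, s * ∏ i, r (y i) ≤
      ((∏ i, f (y i)) * A y + (∏ i, g (y i)) * B y) +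
        s / 4 * ((∏ i, f (y i)) + ∏ i, g (y i)) := fun y => by
    have h1 : (∏ i, r (y i)) ^ 2 ≤ (∏ i, f (y i)) * ∏ i, g (y i) := by
      rw [← Finset.prod_pow, ← Finset.prod_mul_distrib]
      exact Finset.prod_le_prod' fun i _ => hrfg _
    generalize (∏ i, f (y i)) = p at *
    generalize (∏ i, g (y i)) = q at *
    calc s * ∏ i, r (y i) ≤ s * (min p q + (p + q) / 4) := by gcongr; exact le_min_add_quarter h1
      _ = s * min p q + s / 4 * (p + q) := by
        rw [mul_add, ENNReal.div_eq_inv_mul, ENNReal.div_eq_inv_mul]; ring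
      _ ≤ (A y + B y) * min p q + s / 4 * (p + q) := by gcongr; exact hAB y
      _ = (min p q * A y + min p q * B y) + s / 4 * (p + q) := by ring
      _ ≤ _ := by gcongr <;> simp
  have h2 := lintegral_mono (μ := ν) key
  have hfA : Measurable fun y => (∏ i, f (y i)) * A y := (hprod hf).mul hA
  have hgB : Measurable fun y => (∏ i, g (y i)) * B y := (hprod hg).mul hB
  have hfg : Measurable fun y : Fin n → E => (∏ i, f (y i)) + ∏ i, g (y i) :=
    (hprod hf).add (hprod hg)
  rw [lintegral_const_mul _ (hprod hr), hint hr, lintegral_add_right _ (hfg.const_mul _),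
    lintegral_add_left hfA, lintegral_const_mul _ hfg, lintegral_add_left (hprod hf), hint hf,
    hint hg, hf1, hg1, one_pow] at h2
  refine (ENNReal.add_le_add_iff_right (a := s / 4 * (1 + 1)) (by finiteness)).1 ?_
  refine le_trans (le_trans (le_of_eq ?_) (mul_le_mul_right hr1 s)) h2
  rw [ENNReal.div_eq_inv_mul, ENNReal.div_eq_inv_mul]
  ring

/-! ### Step functions on a uniform partition. -/

/-- The index of the cell of length `1 / N` that contains `x`. -/
noncomputable def cellIndex (N : ℕ) (x : I) : ℕ := ⌊(N : ℝ) * x⌋₊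

theorem measurable_cellIndex (N : ℕ) : Measurable (cellIndex N) :=
  Nat.measurable_floor.comp (measurable_subtype_coe.const_mul _)

theorem volume_cellIndex_preimage {N : ℕ} (hN : 0 < N) {j : ℕ} (hj : j < N) :
    volume (cellIndex N ⁻¹' {j}) = ENNReal.ofReal (1 / N) := by
  have hN' : (0 : ℝ) < N := by exact_mod_cast hN
  have hj' : (j : ℝ) + 1 ≤ N := by exact_mod_cast hj
  have h : cellIndex N ⁻¹' {j} =
      Set.Ico (⟨j / N, by positivity, by rw [div_le_one hN']; linarith⟩ : I)
        ⟨(j + 1) / N, by positivity, by rwa [div_le_one hN']⟩ := by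
    ext x
    have hx : 0 ≤ (N : ℝ) * x := mul_nonneg hN'.le x.2.1
    rw [Set.mem_preimage, Set.mem_singleton_iff, cellIndex, Nat.floor_eq_iff hx, Set.mem_Ico,
      ← Subtype.coe_le_coe, ← Subtype.coe_lt_coe, div_le_iff₀ hN', lt_div_iff₀ hN',
      mul_comm (N : ℝ)]
  rw [h, unitInterval.volume_Ico]
  congr 1
  simp only
  ring

theorem volume_cellIndex_preimage_of_le {N : ℕ} {j : ℕ} (hN : 0 < N) (hj : N ≤ j) :
    volume (cellIndex N ⁻¹' {j}) = 0 := by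
  -- The right endpoint `1` has index `N`; no other point has an index of `N` or more.
  refine measure_mono_null (t := {1}) (fun x hx => ?_) (by simp)
  have hN' : (0 : ℝ) < N := by exact_mod_cast hN
  have hx' : j ≤ ⌊(N : ℝ) * x⌋₊ := (Set.mem_singleton_iff.1 hx).ge
  have h1 : (N : ℝ) ≤ N * x :=
    le_trans (Nat.cast_le.2 (hj.trans hx')) (Nat.floor_le (mul_nonneg hN'.le x.2.1))
  have h2 : (1 : ℝ) ≤ x := by nlinarith
  exact Subtype.ext (le_antisymm x.2.2 h2)

theorem lintegral_comp_cellIndex {N : ℕ} (hN : 0 < N) {F : ℕ → ℝ} (hF : ∀ j, 0 ≤ F j) :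
    ∫⁻ x, ENNReal.ofReal (F (cellIndex N x)) =
      ENNReal.ofReal ((∑ j ∈ Finset.range N, F j) / N) := by
  rw [← lintegral_map (f := fun j => ENNReal.ofReal (F j)) (measurable_of_countable _)
    (measurable_cellIndex N), lintegral_countable', tsum_eq_sum (s := Finset.range N),
    Finset.sum_div, ENNReal.ofReal_sum_of_nonneg fun j _ => by have := hF j; positivity]
  · refine Finset.sum_congr rfl fun j hj => ?_
    rw [Measure.map_apply (measurable_cellIndex N) (measurableSet_singleton j),
      volume_cellIndex_preimage hN (Finset.mem_range.1 hj), ← ENNReal.ofReal_mul (hF j),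
      mul_one_div]
  · intro j hj
    rw [Measure.map_apply (measurable_cellIndex N) (measurableSet_singleton j),
      volume_cellIndex_preimage_of_le hN (by simpa using hj), mul_zero]

/-- The index is monotone, and `F` changes only when it grows by at least one. Each increment is
thus at most `K` times the index increment, and these telescope to at most `N`. -/
theorem eVariationOn_comp_cellIndex_le {N : ℕ} {F : ℕ → ℝ} {K : ℝ}
    (hF : ∀ i j, |F i - F j| ≤ K) :
    eVariationOn (fun x => F (cellIndex N x)) Set.univ ≤ ENNReal.ofReal (K * N) := by
  have hK : 0 ≤ K := (abs_nonneg _).trans (hF 0 0)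
  have hmono : Monotone (cellIndex N) := fun x y hxy =>
    Nat.floor_mono (mul_le_mul_of_nonneg_left (Subtype.coe_le_coe.2 hxy) (Nat.cast_nonneg N))
  have hle : ∀ x, cellIndex N x ≤ N := fun x => by
    refine Nat.floor_le_of_le ?_
    nlinarith [x.2.2, (Nat.cast_nonneg N : (0 : ℝ) ≤ N)]
  refine iSup_le fun p => ?_
  obtain ⟨n, u, hu, -⟩ := p
  have hstep : ∀ i, edist (F (cellIndex N (u (i + 1)))) (F (cellIndex N (u i))) ≤
      ENNReal.ofReal (K * (cellIndex N (u (i + 1)) - cellIndex N (u i))) := fun i => by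
    rw [edist_dist, Real.dist_eq]
    refine ENNReal.ofReal_le_ofReal ?_
    rcases (hmono (hu i.le_succ)).eq_or_lt with h | h
    · simp only [Nat.succ_eq_add_one] at h
      simp [h]
    · have : (cellIndex N (u i) : ℝ) + 1 ≤ cellIndex N (u (i + 1)) := by exact_mod_cast h
      exact (hF _ _).trans (le_mul_of_one_le_right hK (by linarith))
  refine (Finset.sum_le_sum fun i _ => hstep i).trans ?_
  rw [← ENNReal.ofReal_sum_of_nonneg, ← Finset.mul_sum,
    Finset.sum_range_sub fun i => (cellIndex N (u i) : ℝ)]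
  · refine ENNReal.ofReal_le_ofReal (mul_le_mul_of_nonneg_left ?_ hK)
    have : (cellIndex N (u n) : ℝ) ≤ N := by exact_mod_cast hle _
    linarith [(Nat.cast_nonneg (cellIndex N (u 0)) : (0 : ℝ) ≤ _)]
  · intro i _
    have : (cellIndex N (u i) : ℝ) ≤ cellIndex N (u (i + 1)) := by
      exact_mod_cast hmono (hu i.le_succ)
    exact mul_nonneg hK (by linarith)

/-! ### The perturbed densities. -/

/-- The sign of the perturbation on half-cell `j`: opposite on the two halves `2k`, `2k+1` of cell
`k`, with the orientation chosen by whether `k ∈ S`. -/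
def cellSign (S : Finset ℕ) (j : ℕ) : ℝ := if (Even j ↔ j / 2 ∈ S) then 1 else -1

theorem cellSign_eq_or (S : Finset ℕ) (j : ℕ) : cellSign S j = 1 ∨ cellSign S j = -1 := by
  unfold cellSign
  split_ifs <;> simp

theorem cellSign_two_mul_add (S : Finset ℕ) (k : ℕ) :
    cellSign S (2 * k) + cellSign S (2 * k + 1) = 0 := by
  have h1 : 2 * k / 2 = k := by omega
  have h2 : (2 * k + 1) / 2 = k := by omega
  by_cases hk : k ∈ S <;> simp [cellSign, h1, h2, hk]

theorem cellSign_symmDiff_of_ne (S : Finset ℕ) {j k : ℕ} (h : j / 2 ≠ k) :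
    cellSign (symmDiff S {k}) j = cellSign S j := by
  simp [cellSign, Finset.mem_symmDiff, h]

theorem cellSign_symmDiff (S : Finset ℕ) {j k : ℕ} (h : j / 2 = k) :
    cellSign (symmDiff S {k}) j = -cellSign S j := by
  by_cases hk : k ∈ S <;> by_cases hj : Even j <;>
    simp [cellSign, Finset.mem_symmDiff, h, hk, hj]

/-- The perturbed uniform density with amplitude `a` on `m` cells. -/
noncomputable def stepDensity (m : ℕ) (a : ℝ) (S : Finset ℕ) (x : I) : ℝ :=
  1 + a * cellSign S (cellIndex (2 * m) x)

theorem measurable_stepDensity (m : ℕ) (a : ℝ) (S : Finset ℕ) : Measurable (stepDensity m a S) :=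
  (measurable_of_countable fun j => 1 + a * cellSign S j).comp (measurable_cellIndex _)

theorem sum_range_two_mul (m : ℕ) (F : ℕ → ℝ) :
    ∑ j ∈ Finset.range (2 * m), F j = ∑ k ∈ Finset.range m, (F (2 * k) + F (2 * k + 1)) := by
  induction m with
  | zero => simp
  | succ m ih => rw [Finset.sum_range_succ, ← ih, mul_add, mul_one, Finset.sum_range_succ,
      Finset.sum_range_succ, add_assoc]

theorem one_add_mul_cellSign_nonneg {a : ℝ} (ha0 : 0 ≤ a) (ha1 : a ≤ 1) (S : Finset ℕ) (j : ℕ) :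
    0 ≤ 1 + a * cellSign S j := by
  rcases cellSign_eq_or S j with h | h <;> rw [h] <;> linarith

theorem lintegral_stepDensity {m : ℕ} (hm : 0 < m) {a : ℝ} (ha0 : 0 ≤ a) (ha1 : a ≤ 1)
    (S : Finset ℕ) : ∫⁻ x, ENNReal.ofReal (stepDensity m a S x) = 1 := by
  have hm' : (m : ℝ) ≠ 0 := by exact_mod_cast hm.ne'
  refine (lintegral_comp_cellIndex (N := 2 * m) (by omega)
    (one_add_mul_cellSign_nonneg ha0 ha1 S)).trans ?_
  have h : ∀ k, 1 + a * cellSign S (2 * k) + (1 + a * cellSign S (2 * k + 1)) = 2 := fun k => by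
    linear_combination a * cellSign_two_mul_add S k
  simp only [sum_range_two_mul, h, Finset.sum_const, Finset.card_range, nsmul_eq_mul]
  push_cast
  rw [mul_comm, div_self (by positivity), ENNReal.ofReal_one]

theorem stepDensity_mem_densityClass {η Γ : ℝ} (hη : 0 ≤ η) {m : ℕ} (hm : 0 < m) {a : ℝ}
    (ha0 : 0 ≤ a) (ha : a ≤ 1 - η) (haΓ : 4 * a * m ≤ Γ) (S : Finset ℕ) :
    stepDensity m a S ∈ densityClass η Γ := by
  have hle : ∀ y, η ≤ stepDensity m a S y := fun y => by
    unfold stepDensity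
    rcases cellSign_eq_or S (cellIndex (2 * m) y) with h | h <;> rw [h] <;> linarith
  refine ⟨measurable_stepDensity m a S, fun y => hη.trans (hle y),
    lintegral_stepDensity hm ha0 (by linarith) S, hle, ?_⟩
  -- Values differ by at most `2 * a`, over `2 * m` half-cells: this is the `4 * a * m` of `haΓ`.
  refine (eVariationOn_comp_cellIndex_le (N := 2 * m) (F := fun j => 1 + a * cellSign S j)
    (K := 2 * a) fun i j => ?_).trans (ENNReal.ofReal_le_ofReal ?_)
  · rw [abs_le]
    rcases cellSign_eq_or S i with h | h <;> rcases cellSign_eq_or S j with h' | h' <;>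
      rw [h, h'] <;> constructor <;> linarith
  · push_cast
    linarith

/-! ### Flipping one cell. -/

/-- The part of `[0,1]` on which flipping the membership of `k` changes the density. -/
def cell (m k : ℕ) : Set I := {x | cellIndex (2 * m) x / 2 = k}

theorem measurableSet_cell (m k : ℕ) : MeasurableSet (cell m k) :=
  measurable_cellIndex (2 * m) (Set.to_countable {j | j / 2 = k}).measurableSet

theorem sum_ite_half_eq {m k : ℕ} (hk : k < m) (u : ℝ) :
    ∑ j ∈ Finset.range (2 * m), (if j / 2 = k then u else 0) = 2 * u := by
  have h1 : ∀ i, 2 * i / 2 = i := fun i => by omega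
  have h2 : ∀ i, (2 * i + 1) / 2 = i := fun i => by omega
  simp only [sum_range_two_mul, h1, h2, Finset.sum_add_distrib, Finset.sum_ite_eq',
    Finset.mem_range, hk, if_true]
  ring

theorem volume_cell {m k : ℕ} (hk : k < m) : volume (cell m k) = ENNReal.ofReal (1 / m) := by
  have hm' : (m : ℝ) ≠ 0 := by exact_mod_cast (by omega : m ≠ 0)
  have h := lintegral_comp_cellIndex (N := 2 * m) (by omega)
    (F := fun j => if j / 2 = k then 1 else 0) fun j => by positivity
  rw [sum_ite_half_eq hk] at h
  rw [← lintegral_indicator_one (measurableSet_cell m k)]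
  refine (lintegral_congr fun x => ?_).trans (h.trans ?_)
  · by_cases hx : cellIndex (2 * m) x / 2 = k <;> simp [Set.indicator, cell, hx]
  · congr 1
    push_cast
    field_simp

/-- A common lower envelope for the geometric mean of two neighbouring densities. -/
noncomputable def meanEnvelope (m : ℕ) (a : ℝ) (S : Finset ℕ) (k : ℕ) (x : I) : ℝ :=
  if cellIndex (2 * m) x / 2 = k then 1 - a ^ 2 else stepDensity m a S x

theorem measurable_meanEnvelope (m : ℕ) (a : ℝ) (S : Finset ℕ) (k : ℕ) :
    Measurable (meanEnvelope m a S k) :=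
  Measurable.ite (measurableSet_cell m k) measurable_const (measurable_stepDensity m a S)

theorem lintegral_meanEnvelope {m k : ℕ} (hk : k < m) {a : ℝ} (ha0 : 0 ≤ a) (ha1 : a ≤ 1)
    (S : Finset ℕ) :
    ∫⁻ x, ENNReal.ofReal (meanEnvelope m a S k x) = ENNReal.ofReal (1 - a ^ 2 / m) := by
  have hm' : (m : ℝ) ≠ 0 := by exact_mod_cast (by omega : m ≠ 0)
  refine (lintegral_comp_cellIndex (N := 2 * m) (by omega)
    (F := fun j => if j / 2 = k then 1 - a ^ 2 else 1 + a * cellSign S j) fun j => ?_).trans ?_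
  · split_ifs
    · nlinarith
    · exact one_add_mul_cellSign_nonneg ha0 ha1 S j
  · have h1 : ∀ i, 2 * i / 2 = i := fun i => by omega
    have h2 : ∀ i, (2 * i + 1) / 2 = i := fun i => by omega
    have h : ∀ i, ((if i = k then 1 - a ^ 2 else 1 + a * cellSign S (2 * i)) +
        if i = k then 1 - a ^ 2 else 1 + a * cellSign S (2 * i + 1)) =
          2 + if i = k then -2 * a ^ 2 else 0 := fun i => by
      split_ifs
      · ring
      · linear_combination a * cellSign_two_mul_add S i
    simp only [sum_range_two_mul, h1, h2, h, Finset.sum_add_distrib, Finset.sum_ite_eq',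
      Finset.mem_range, hk, if_true, Finset.sum_const, Finset.card_range, nsmul_eq_mul]
    congr 1
    push_cast
    field_simp
    ring

/-- On cell `k` the two densities multiply to `(1 + a) * (1 - a) = 1 - a ^ 2`, which dominates its
own square as it lies in `[0,1]`; elsewhere they agree. Using `1 - a ^ 2` instead of its root keeps
the envelope polynomial and costs only a constant. -/
theorem sq_meanEnvelope_le {a : ℝ} (ha0 : 0 ≤ a) (ha1 : a ≤ 1) (m : ℕ) (S : Finset ℕ) (k : ℕ)
    (x : I) : meanEnvelope m a S k x ^ 2 ≤
      stepDensity m a S x * stepDensity m a (symmDiff S {k}) x := by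
  unfold meanEnvelope stepDensity
  split_ifs with h
  · rw [cellSign_symmDiff S h]
    rcases cellSign_eq_or S (cellIndex (2 * m) x) with h' | h' <;> rw [h'] <;>
      nlinarith [mul_nonneg (sq_nonneg a) (by nlinarith : 0 ≤ 1 - a ^ 2)]
  · rw [cellSign_symmDiff_of_ne S h, sq]

/-- The squared error on a single cell. -/
noncomputable def cellLoss (m : ℕ) (a : ℝ) (S : Finset ℕ) (k : ℕ) (g : I → ℝ) : ℝ≥0∞ :=
  ∫⁻ x in cell m k, ENNReal.ofReal ((stepDensity m a S x - g x) ^ 2)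

/-- On the cell the two densities take the values `1 + a` and `1 - a`, and `(1 + a - g) ^ 2 + (1 - a
- g) ^ 2 = 2 * a ^ 2 + 2 * (1 - g) ^ 2`. -/
theorem le_cellLoss_add_cellLoss {m k : ℕ} (hk : k < m) (a : ℝ) (S : Finset ℕ) {g : I → ℝ}
    (hg : Measurable g) : ENNReal.ofReal (2 * a ^ 2 / m) ≤
      cellLoss m a S k g + cellLoss m a (symmDiff S {k}) k g := by
  calc ENNReal.ofReal (2 * a ^ 2 / m)
      = ∫⁻ _ in cell m k, ENNReal.ofReal (2 * a ^ 2) := by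
        rw [setLIntegral_const, volume_cell hk, ← ENNReal.ofReal_mul (by positivity), mul_one_div]
    _ ≤ ∫⁻ x in cell m k, (ENNReal.ofReal ((stepDensity m a S x - g x) ^ 2) +
          ENNReal.ofReal ((stepDensity m a (symmDiff S {k}) x - g x) ^ 2)) := by
        refine setLIntegral_mono' (measurableSet_cell m k) fun x hx => ?_
        rw [← ENNReal.ofReal_add (sq_nonneg _) (sq_nonneg _)]
        refine ENNReal.ofReal_le_ofReal ?_
        unfold stepDensity
        rw [cellSign_symmDiff S hx]
        rcases cellSign_eq_or S (cellIndex (2 * m) x) with h | h <;> rw [h] <;>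
          nlinarith [sq_nonneg (1 - g x)]
    _ = _ := lintegral_add_left
        (((measurable_stepDensity m a S).sub hg).pow_const 2).ennreal_ofReal _

theorem sum_cellLoss_le (m : ℕ) (a : ℝ) (S : Finset ℕ) (g : I → ℝ) :
    ∑ k ∈ Finset.range m, cellLoss m a S k g ≤ sqL2Loss (stepDensity m a S) g := by
  unfold cellLoss sqL2Loss
  rw [← lintegral_biUnion_finset _ fun k _ => measurableSet_cell m k]
  · exact setLIntegral_le_lintegral _ _
  · exact fun i _ j _ hij => Set.disjoint_left.2 fun x hi hj => hij (hi.symm.trans hj)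

theorem measurable_cellLoss {n : ℕ} {fhat : (Fin n → I) → I → ℝ} (h : IsDensityEstimator n fhat)
    (m : ℕ) (a : ℝ) (S : Finset ℕ) (k : ℕ) : Measurable fun y => cellLoss m a S k (fhat y) := by
  refine Measurable.lintegral_prod_right'
    (f := fun p : (Fin n → I) × I => ENNReal.ofReal ((stepDensity m a S p.2 - fhat p.1 p.2) ^ 2)) ?_
  exact ((((measurable_stepDensity m a S).comp measurable_snd).sub h).pow_const 2).ennreal_ofReal

/-- Flipping the membership of `k` in `S` costs any estimator a fixed risk on cell `k`. -/
theorem flip_risk_bound {n m k : ℕ} (hk : k < m) {a : ℝ} (ha0 : 0 ≤ a) (ha1 : a ≤ 1)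
    (hn : 4 * n * a ^ 2 ≤ m) {fhat : (Fin n → I) → I → ℝ} (h : IsDensityEstimator n fhat)
    (S : Finset ℕ) :
    ENNReal.ofReal (a ^ 2 / (2 * m)) ≤
      ∫⁻ y, cellLoss m a S k (fhat y) ∂(sampleLaw n (stepDensity m a S)) +
      ∫⁻ y, cellLoss m a (symmDiff S {k}) k (fhat y)
        ∂(sampleLaw n (stepDensity m a (symmDiff S {k}))) := by
  have hm : 0 < m := by omega
  have hm' : (0 : ℝ) < m := by exact_mod_cast hm
  have hm1 : (1 : ℝ) ≤ m := by exact_mod_cast hm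
  have ha2 : a ^ 2 / m ≤ 1 := by rw [div_le_one hm']; nlinarith
  have hs : ENNReal.ofReal (a ^ 2 / (2 * m)) = ENNReal.ofReal (2 * a ^ 2 / m) / 4 := by
    rw [show (4 : ℝ≥0∞) = ENNReal.ofReal 4 by simp, ← ENNReal.ofReal_div_of_pos (by norm_num)]
    congr 1
    field_simp
    norm_num
  rw [hs]
  refine two_point_bound volume (measurable_stepDensity m a S).ennreal_ofReal
    (measurable_stepDensity m a _).ennreal_ofReal
    (measurable_meanEnvelope m a S k).ennreal_ofReal (lintegral_stepDensity hm ha0 ha1 S)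
    (lintegral_stepDensity hm ha0 ha1 _) (fun x => ?_) ?_ (measurable_cellLoss h m a S k)
    (measurable_cellLoss h m a _ k) ENNReal.ofReal_ne_top fun y =>
      le_cellLoss_add_cellLoss hk a S (h.comp measurable_prodMk_left)
  · have h0 := one_add_mul_cellSign_nonneg ha0 ha1 S (cellIndex (2 * m) x)
    have hr : 0 ≤ meanEnvelope m a S k x := by
      unfold meanEnvelope
      split_ifs
      · nlinarith
      · exact h0
    rw [← ENNReal.ofReal_pow hr, ← ENNReal.ofReal_mul (by exact h0)]
    exact ENNReal.ofReal_le_ofReal (sq_meanEnvelope_le ha0 ha1 m S k x)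
  -- Bernoulli's inequality: `(1 - a ^ 2 / m) ^ n ≥ 1 - n * a ^ 2 / m`, and `hn` makes this at least
  -- `3 / 4`.
  · have hb := one_add_mul_le_pow (a := -(a ^ 2 / m)) (by linarith) n
    have hn' : n * (a ^ 2 / m) ≤ 1 / 4 := by
      rw [← mul_div_assoc, div_le_iff₀ hm']
      linarith
    rw [lintegral_meanEnvelope hk ha0 ha1, ← ENNReal.ofReal_pow (by linarith),
      show (3 / 4 : ℝ≥0∞) = ENNReal.ofReal (3 / 4) by
        rw [ENNReal.ofReal_div_of_pos (by norm_num)]; simp]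
    refine ENNReal.ofReal_le_ofReal ?_
    rw [← sub_eq_add_neg] at hb
    linarith

/-! ### Averaging over all sign patterns. -/

theorem sum_powerset_symmDiff {M : Type*} [AddCommMonoid M] {T : Finset ℕ} {k : ℕ} (hk : k ∈ T)
    (F : Finset ℕ → M) :
    ∑ S ∈ T.powerset, F (symmDiff S {k}) = ∑ S ∈ T.powerset, F S := by
  have hmem : ∀ S ∈ T.powerset, symmDiff S {k} ∈ T.powerset := fun S hS => by
    rw [Finset.mem_powerset] at hS ⊢
    intro j hj
    rcases Finset.mem_symmDiff.1 hj with hj | hj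
    · exact hS hj.1
    · rwa [Finset.mem_singleton.1 hj.1]
  exact Finset.sum_nbij' (fun S => symmDiff S {k}) (fun S => symmDiff S {k}) hmem hmem
    (fun S _ => by simp) (fun S _ => by simp) fun S _ => rfl

/-- Assouad's bound for the cell perturbations. -/
theorem le_densityMinimaxRisk {η Γ : ℝ} (hη : 0 ≤ η) {n m : ℕ} (hm : 0 < m) {a : ℝ} (ha0 : 0 ≤ a)
    (ha : a ≤ 1 - η) (haΓ : 4 * a * m ≤ Γ) (hn : 4 * n * a ^ 2 ≤ m) :
    ENNReal.ofReal (a ^ 2 / 4) ≤ densityMinimaxRisk η Γ n := by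
  refine le_iInf₂ fun fhat hfhat => ?_
  set R := ⨆ f ∈ densityClass η Γ, ∫⁻ y, sqL2Loss f (fhat y) ∂(sampleLaw n f)
  set X : Finset ℕ → ℕ → ℝ≥0∞ := fun S k =>
    ∫⁻ y, cellLoss m a S k (fhat y) ∂(sampleLaw n (stepDensity m a S))
  set T := Finset.range m
  have hm' : (m : ℝ) ≠ 0 := by exact_mod_cast hm.ne'
  have hR : ∀ S, ∑ k ∈ T, X S k ≤ R := fun S => by
    rw [← lintegral_finsetSum _ fun k _ => measurable_cellLoss hfhat m a S k]
    exact (lintegral_mono fun y => sum_cellLoss_le m a S (fhat y)).trans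
      (le_iSup₂_of_le _ (stepDensity_mem_densityClass hη hm ha0 ha haΓ S) le_rfl)
  -- Flipping bit `k` permutes the patterns, so summing the flip bound over all of them counts each
  -- risk on cell `k` twice.
  have hk : ∀ k ∈ T, (2 : ℝ≥0∞) ^ m * ENNReal.ofReal (a ^ 2 / (2 * m)) ≤
      2 * ∑ S ∈ T.powerset, X S k := fun k hk => by
    have hcard : ∑ _S ∈ T.powerset, ENNReal.ofReal (a ^ 2 / (2 * m)) =
        (2 : ℝ≥0∞) ^ m * ENNReal.ofReal (a ^ 2 / (2 * m)) := by
      simp [T, Finset.card_powerset]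
    calc _ = _ := hcard.symm
      _ ≤ ∑ S ∈ T.powerset, (X S k + X (symmDiff S {k}) k) := Finset.sum_le_sum fun S _ =>
          flip_risk_bound (Finset.mem_range.1 hk) ha0 (by linarith) hn hfhat S
      _ = _ := by
          rw [Finset.sum_add_distrib, sum_powerset_symmDiff hk fun S => X S k, two_mul]
  have hsum : (2 : ℝ≥0∞) ^ m * ENNReal.ofReal (a ^ 2 / 2) ≤ 2 ^ m * (2 * R) := by
    calc (2 : ℝ≥0∞) ^ m * ENNReal.ofReal (a ^ 2 / 2)
        = ∑ _k ∈ T, (2 : ℝ≥0∞) ^ m * ENNReal.ofReal (a ^ 2 / (2 * m)) := by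
          rw [Finset.sum_const, Finset.card_range, nsmul_eq_mul, mul_left_comm,
            ← ENNReal.ofReal_natCast, ← ENNReal.ofReal_mul (by positivity)]
          congr 2
          field_simp
      _ ≤ ∑ k ∈ T, 2 * ∑ S ∈ T.powerset, X S k := Finset.sum_le_sum hk
      _ = 2 * ∑ S ∈ T.powerset, ∑ k ∈ T, X S k := by rw [← Finset.mul_sum, Finset.sum_comm]
      _ ≤ 2 * ∑ _S ∈ T.powerset, R := by gcongr; exact hR _
      _ = _ := by simp [T, Finset.card_powerset]; ring
  rw [ENNReal.mul_le_mul_iff_right (by simp) (by finiteness)] at hsum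
  rw [← ENNReal.mul_le_mul_iff_right (a := 2) (by simp) (by simp)]
  refine le_trans (le_of_eq ?_) hsum
  rw [show (2 : ℝ≥0∞) = ENNReal.ofReal 2 by simp, ← ENNReal.ofReal_mul (by norm_num)]
  congr 1
  ring

/-! ### Choice of parameters and the rate. -/

/-- Take `a = b / m`, so that `4 * a * m = 4 * b ≤ Γ`. The sample size condition becomes `4 * n * b
^ 2 ≤ m ^ 3`, met by `m = ⌈2 * t⌉₊` with `t ^ 3 = n + 1`. Using `n + 1` gives `t ≥ 1` even for `n =
0`; then `m ≤ 3 * t`, whence the constant `36 = 4 * 3 ^ 2`. -/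
theorem exists_risk_lower_bound {η Γ : ℝ} (hη0 : 0 < η) (hη1 : η < 1) (hΓ : 0 < Γ) :
    ∃ c : ℝ, 0 < c ∧ ∀ n : ℕ,
      ENNReal.ofReal (c * ((n : ℝ) + 1) ^ (-(2 / 3) : ℝ)) ≤ densityMinimaxRisk η Γ n := by
  set b := min (1 - η) (Γ / 4)
  have hb : 0 < b := lt_min (by linarith) (by linarith)
  have hb1 : b ≤ 1 - η := min_le_left _ _
  have hb2 : b ≤ Γ / 4 := min_le_right _ _
  refine ⟨b ^ 2 / 36, by positivity, fun n => ?_⟩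
  set t : ℝ := ((n : ℝ) + 1) ^ (1 / 3 : ℝ)
  have hn1 : (1 : ℝ) ≤ (n : ℝ) + 1 := by linarith [(Nat.cast_nonneg n : (0 : ℝ) ≤ n)]
  have ht1 : 1 ≤ t := Real.one_le_rpow hn1 (by norm_num)
  have ht3 : t ^ 3 = (n : ℝ) + 1 := by
    rw [← Real.rpow_natCast, ← Real.rpow_mul (by linarith)]
    norm_num
  have ht2 : ((n : ℝ) + 1) ^ (-(2 / 3) : ℝ) = 1 / t ^ 2 := by
    rw [← Real.rpow_natCast t, ← Real.rpow_mul (by linarith), Real.rpow_neg (by linarith), one_div]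
    norm_num
  set m := ⌈2 * t⌉₊
  have hm2 : 2 * t ≤ m := Nat.le_ceil _
  have hm3 : (m : ℝ) ≤ 3 * t := by
    have := Nat.ceil_lt_add_one (a := 2 * t) (by linarith)
    linarith
  have hm0 : (0 : ℝ) < m := by linarith
  have hcube : 4 * (n : ℝ) ≤ m * (m : ℝ) ^ 2 := by
    have h := pow_le_pow_left₀ (by linarith) hm2 3
    nlinarith
  have hdiv : b / m ≤ b := div_le_self hb.le (by linarith)
  refine le_trans (ENNReal.ofReal_le_ofReal ?_) (le_densityMinimaxRisk hη0.le
    (by exact_mod_cast hm0 : 0 < m) (a := b / m) (by positivity) (hdiv.trans hb1) ?_ ?_)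
  · rw [ht2, div_pow, div_mul_div_comm, div_div, mul_one]
    refine div_le_div_of_nonneg_left (by positivity) (by positivity) ?_
    nlinarith
  · rw [mul_assoc, div_mul_cancel₀ _ hm0.ne']
    linarith
  · rw [div_pow, ← mul_div_assoc, div_le_iff₀ (by positivity)]
    have : b ^ 2 ≤ 1 := by nlinarith
    nlinarith [(Nat.cast_nonneg n : (0 : ℝ) ≤ n)]

theorem mainTheorem8 (η Γ : ℝ) (hη0 : 0 < η) (hη1 : η < 1) (hΓ : 0 < Γ) :
    (∃ c : ℝ, 0 < c ∧ ∃ δ₀ : ℝ, 0 < δ₀ ∧ ∀ δ : ℝ, 0 < δ → δ ≤ δ₀ → ∀ n : ℕ,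
      densityMinimaxRisk η Γ n ≤ ENNReal.ofReal δ →
        c * (1 / δ) ^ (3 / 2 : ℝ) ≤ (n : ℝ)) ∧
    (∃ c : ℝ, 0 < c ∧ ∃ N : ℕ, ∀ n : ℕ, N ≤ n →
      ENNReal.ofReal (c * (n : ℝ) ^ (-(2 / 3) : ℝ)) ≤ densityMinimaxRisk η Γ n) := by
  obtain ⟨c, hc, hrisk⟩ := exists_risk_lower_bound hη0 hη1 hΓ
  constructor
  -- With `δ ≤ c / 4`, the quantity `(c / δ) ^ (3 / 2)` is at least `2`, so passing from `n + 1` to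
  -- `n` costs at most half of it.
  · refine ⟨c ^ (3 / 2 : ℝ) / 2, by positivity, c / 4, by positivity, fun δ hδ hδ₀ n hn => ?_⟩
    have h1 : c * ((n : ℝ) + 1) ^ (-(2 / 3) : ℝ) ≤ δ :=
      (ENNReal.ofReal_le_ofReal_iff hδ.le).1 ((hrisk n).trans hn)
    have hn0 : (0 : ℝ) < (n : ℝ) + 1 := by positivity
    have h2 : c / δ ≤ ((n : ℝ) + 1) ^ (2 / 3 : ℝ) := by
      rw [Real.rpow_neg hn0.le, ← div_eq_mul_inv, div_le_iff₀ (by positivity)] at h1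
      rwa [div_le_iff₀ hδ, mul_comm]
    have h3 : (c / δ) ^ (3 / 2 : ℝ) ≤ (n : ℝ) + 1 := by
      refine (Real.rpow_le_rpow (by positivity) h2 (by norm_num)).trans_eq ?_
      rw [← Real.rpow_mul hn0.le]
      norm_num
    have h4 : 2 ≤ (c / δ) ^ (3 / 2 : ℝ) := by
      have h5 : 4 ≤ c / δ := by
        rw [le_div_iff₀ hδ]
        linarith
      calc (2 : ℝ) ≤ 4 := by norm_num
        _ ≤ c / δ := h5
        _ ≤ _ := Real.self_le_rpow_of_one_le (by linarith) (by norm_num)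
    rw [div_mul_eq_mul_div, ← Real.mul_rpow hc.le (by positivity), mul_one_div]
    linarith
  -- The factor `2 ^ (-(2 / 3))` comes from `n + 1 ≤ 2 * n` for `n ≥ 1`.
  · refine ⟨c * 2 ^ (-(2 / 3) : ℝ), by positivity, 1, fun n hn =>
      le_trans (ENNReal.ofReal_le_ofReal ?_) (hrisk n)⟩
    have hn' : (1 : ℝ) ≤ n := by exact_mod_cast hn
    rw [mul_assoc, ← Real.mul_rpow (by norm_num) (by linarith)]
    exact mul_le_mul_of_nonneg_left (Real.rpow_le_rpow_of_nonpos (by linarith) (by linarith)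
      (by norm_num)) hc.le
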